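/- Let $\hat\theta,m,c,k>0$ with $\left(\frac{c}{2m}\right)^2-\frac{k}{m}<0$, so that the roots of $ms^2+cs+k=0$ are complex conjugate and not real. Consider the hybrid system on $\mathbb R^2$ with flow $$\dot x=f(x)=\Big(x_2,\,-\tfrac{c}{m}x_2-\tfrac{k}{m}x_1\Big),\qquad x\in\mathcal C=\{x:x_1x_2\le 0\}\cup\{x:|x_1|\ge\hat\theta,\ x_1x_2\ge 0\},$$ and jumps $$x^+\in G(x)=\{(\hat\theta s,x_2): s\in\mathrm{SGN}(x_2)\},\qquad x\in\mathcal D=\{x:x_1=0\},$$ where $\mathrm{SGN}(r)=\{\mathrm{sign}(r)\}$ for $r\ne0$ and $\mathrm{SGN}(0)=\{1,-1\}$. Solutions $x(t,j)$ are hybrid arcs on hybrid time domains $\mathrm{dom}(x)\subset[0,\infty)\times\mathbb N$ in the usual sense of Goebel, Sanfelice and Teel. A hybrid periodic trajectory is a complete solution $x$ (one with unbounded domain) for which there are $T\in\mathbb R_{\ge0}$, $J\in\mathbb Z_{\geq 0}$, not both zero, such that for every $(t,j)\in\mathrm{dom}(x)$ also $(t+T,j+J)\in\mathrm{dom}(x)$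 and $x(t,j)=x(t+T,j+J)$. A hybrid periodic orbit is the image of such a trajectory; it is nontrivial if it has more than one point. Let $\mathcal C_0=\{x:|x_1|=\hat\theta,\ x_1x_2\ge0\}\cup\{x:|x_1|\le\hat\theta,\ x_2=0\}$. For a point $x\in\mathcal C$, let $(x_{1b},x_{2b})$ be the intersection with $\mathcal C_0$ reached by flowing within $\mathcal C$ in backward time from $x$, let $(x_{1f},x_{2f})$ be the intersection with $\mathcal D$ reached by flowing within $\mathcal C$ in forward time from $x$ (zero flow time is allowed in both cases), and put $T_b(x)=\frac12 m x_{2b}^2$ and $T_f(x)=\frac12 m x_{2f}^2$ (the backward and forward kinetic energies). Then the hybrid system has exactly one nontrivial hybrid periodic orbit. At every point $x$ of this orbit both intersections exist and are unique, and $T_b(x)=T_f(x)$. -/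

import Mathlib

open Set MeasureTheory

noncomputable section

/-! ## General hybrid systems `(C, F, D, G)`, their solutions and periodic orbits -/

/-- The data of a hybrid system on `X`: flow `x' ∈ F x` on `C`, jump `x⁺ ∈ G x` on `D`. -/
structure HybridSystem (X : Type) where
  /-- flow set -/
  C : Set X
  /-- set-valued flow map -/
  F : X → Set X
  /-- jump set -/
  D : Set X
  /-- set-valued jump map -/
  G : X → Set X

/-- A compact hybrid time domain: `⋃_{j < J} [τ j, τ (j+1)] × {j}` for some finite sequence
`0 = τ 0 ≤ τ 1 ≤ … ≤ τ J`. -/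
def IsCompactHybridTimeDomain (E : Set (ℝ × ℕ)) : Prop :=
  ∃ (J : ℕ) (τ : ℕ → ℝ), τ 0 = 0 ∧ (∀ i < J, τ i ≤ τ (i + 1)) ∧
    E = {p : ℝ × ℕ | p.2 < J ∧ p.1 ∈ Icc (τ p.2) (τ (p.2 + 1))}

/-- A hybrid time domain: a subset `E` of `[0, ∞) × ℕ` all of whose truncations
`E ∩ ([0, T] × {0, …, J})`, `(T, J) ∈ E`, are compact hybrid time domains. -/
def IsHybridTimeDomain (E : Set (ℝ × ℕ)) : Prop :=
  (∀ p ∈ E, 0 ≤ p.1) ∧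
  ∀ p ∈ E, IsCompactHybridTimeDomain (E ∩ (Icc 0 p.1 ×ˢ Iic p.2))

/-- The set of ordinary times `t` with `(t, j) ∈ E`. -/
def timeSlice (E : Set (ℝ × ℕ)) (j : ℕ) : Set ℝ := {t | (t, j) ∈ E}

/-- `φ` with domain `E` is a hybrid arc: `E` is a hybrid time domain and each `φ(·, j)` is locally
absolutely continuous on `{t | (t, j) ∈ E}`. Only the values of `φ` on `E` matter. -/
def IsHybridArc {X : Type} [PseudoMetricSpace X] (E : Set (ℝ × ℕ)) (φ : ℝ → ℕ → X) : Prop :=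
  IsHybridTimeDomain E ∧
  ∀ j : ℕ, ∀ a ∈ timeSlice E j, ∀ b ∈ timeSlice E j,
    AbsolutelyContinuousOnInterval (fun t => φ t j) a b

/-- `φ` with domain `E` is a solution of the hybrid system `H`. -/
def IsHybridSolution {X : Type} [NormedAddCommGroup X] [NormedSpace ℝ X] (H : HybridSystem X)
    (E : Set (ℝ × ℕ)) (φ : ℝ → ℕ → X) : Prop :=
  IsHybridArc E φ ∧
  ((0 : ℝ), 0) ∈ E ∧ φ 0 0 ∈ closure H.C ∪ H.D ∧
  (∀ j : ℕ, (interior (timeSlice E j)).Nonempty →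
    (∀ t ∈ interior (timeSlice E j), φ t j ∈ H.C) ∧
    (∀ᵐ t ∂(volume.restrict (timeSlice E j)),
      ∃ v ∈ H.F (φ t j), HasDerivAt (fun s => φ s j) v t)) ∧
  (∀ (t : ℝ) (j : ℕ), (t, j) ∈ E → (t, j + 1) ∈ E →
    φ t j ∈ H.D ∧ φ t (j + 1) ∈ H.G (φ t j))

/-- A hybrid periodic trajectory: a complete solution (one with unbounded domain) that admits a
period `(T, J)` with `T ≥ 0`, `J > 0` or with `T > 0`, `J ≥ 0`. -/
def IsHybridPeriodicTrajectory {X : Type} [NormedAddCommGroup X] [NormedSpace ℝ X]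
    (H : HybridSystem X) (E : Set (ℝ × ℕ)) (φ : ℝ → ℕ → X) : Prop :=
  IsHybridSolution H E φ ∧ ¬ Bornology.IsBounded E ∧
  ∃ (T : ℝ) (J : ℕ), ((0 ≤ T ∧ 0 < J) ∨ (0 < T ∧ 0 ≤ J)) ∧
    ∀ (t : ℝ) (j : ℕ), (t, j) ∈ E → (t + T, j + J) ∈ E ∧ φ t j = φ (t + T) (j + J)

/-- A hybrid periodic orbit: the image of a hybrid periodic trajectory. -/
def IsHybridPeriodicOrbit {X : Type} [NormedAddCommGroup X] [NormedSpace ℝ X]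
    (H : HybridSystem X) (O : Set X) : Prop :=
  ∃ (E : Set (ℝ × ℕ)) (φ : ℝ → ℕ → X), IsHybridPeriodicTrajectory H E φ ∧
    O = {x | ∃ p ∈ E, φ p.1 p.2 = x}

/-! ## The oscillator with resets -/

/-- The vector field of `m q'' + c q' + k q = 0` in the coordinates `(q, q')`. -/
def oscField (m c k : ℝ) (x : ℝ × ℝ) : ℝ × ℝ := (x.2, -(c / m) * x.2 - (k / m) * x.1)

/-- The flow set. -/
def oscC (θ : ℝ) : Set (ℝ × ℝ) := {x | x.1 * x.2 ≤ 0} ∪ {x | θ ≤ |x.1| ∧ 0 ≤ x.1 * x.2}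

/-- The jump set. -/
def oscD : Set (ℝ × ℝ) := {x | x.1 = 0}

/-- The set-valued sign: `{1}` on positive, `{-1}` on negative numbers and `{1, -1}` at `0`. -/
def setSign (r : ℝ) : Set ℝ := {s | (r ≠ 0 ∧ s = Real.sign r) ∨ (r = 0 ∧ (s = 1 ∨ s = -1))}

/-- The jump map `(x₁, x₂) ↦ (θ · SGN x₂, x₂)`. -/
def oscG (θ : ℝ) (x : ℝ × ℝ) : Set (ℝ × ℝ) := {y | ∃ s ∈ setSign x.2, y = (θ * s, x.2)}

/-- The planar hybrid reset system. -/
def resetSystem (θ m c k : ℝ) : HybridSystem (ℝ × ℝ) where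
  C := oscC θ
  F := fun x => {oscField m c k x}
  D := oscD
  G := oscG θ

/-! ## Backward and forward kinetic energies -/

/-- The curve of (generalized) post-jump states from which flows start. -/
def curveC0 (θ : ℝ) : Set (ℝ × ℝ) :=
  {x | |x.1| = θ ∧ 0 ≤ x.1 * x.2} ∪ {x | |x.1| ≤ θ ∧ x.2 = 0}

/-- In some time `s ≥ 0` the flow leads from `x` to `y` inside the flow set. -/
def FlowsTo (θ m c k : ℝ) (x y : ℝ × ℝ) : Prop :=
  ∃ (s : ℝ) (z : ℝ → ℝ × ℝ), 0 ≤ s ∧ z 0 = x ∧ z s = y ∧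
    ∀ t ∈ Icc 0 s, z t ∈ oscC θ ∧ HasDerivWithinAt z (oscField m c k (z t)) (Icc 0 s) t

/-- `b` is an intersection with `C₀` when flowing in backward time from `x`. -/
def IsBackwardIntersection (θ m c k : ℝ) (x b : ℝ × ℝ) : Prop :=
  b ∈ curveC0 θ ∧ FlowsTo θ m c k b x

/-- `e` is an intersection with the jump set when flowing in forward time from `x`. -/
def IsForwardIntersection (θ m c k : ℝ) (x e : ℝ × ℝ) : Prop :=
  e ∈ oscD ∧ FlowsTo θ m c k x e

/-- The backward kinetic energy `T_b(x) = m x_{2b}² / 2`; meaningful where the backward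
intersection exists and is unique. -/
def backwardKinetic (θ m c k : ℝ) (x : ℝ × ℝ) : ℝ :=
  1 / 2 * m * (Classical.epsilon (IsBackwardIntersection θ m c k x)).2 ^ 2

/-- The forward kinetic energy `T_f(x) = m x_{2f}² / 2`; meaningful where the forward
intersection exists and is unique. -/
def forwardKinetic (θ m c k : ℝ) (x : ℝ × ℝ) : ℝ :=
  1 / 2 * m * (Classical.epsilon (IsForwardIntersection θ m c k x)).2 ^ 2

end

/-! The characteristic roots are `-a ± iω`. Up to the symmetry `x ↦ -x`, a reset launches the state
from `(θ, v)` with `v ≥ 0`. The motion that follows is an explicit `arc` with phase `β` in `(0, π)`,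
which meets `x₁ = 0` at time `β / ω`. It stays in the flow set until then and leaves it directly
afterwards, so a solution has to jump exactly at that moment.

A reset keeps `x₂`, so the dynamics reduce to the scalar map from launch speed to arrival speed.
Both speeds increase strictly with `β` (`arc_zero_snd_lt`, `arc_end_snd_lt`), so this return map is
strictly increasing and its periodic points are fixed points (`isClosing_of_periodic`). The fixed
points are the zeros in `(0, π)` of `g β = a sin β + ω cos β + ω exp (-aβ/ω)`. One exists because `g
0 > 0 > g π`; two cannot, because `g` is convex beyond a zero (`IsClosing.not_lt`).

A nontrivial periodic orbit therefore consists of the arc of that phase and its mirror image, and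
this alternation is indeed a solution. Periods without jumps are excluded by damping, periods of
zero duration because a reset state is off the jump set. On the orbit, the backward and forward
kinetic energies are those at launch and at arrival, which agree at the fixed point. -/

section Flow

variable {a ω θ β : ℝ}

/-! ### Conserved energy and uniqueness for the damped flow. -/

/-- The vector field of the damped oscillator with decay rate `a` and angular frequency `ω`. -/
def dampedField (a ω : ℝ) (x : ℝ × ℝ) : ℝ × ℝ := (x.2, -(2 * a) * x.2 - (a ^ 2 + ω ^ 2) * x.1)

lemma dampedField_smul (σ : ℝ) (x : ℝ × ℝ) :
    dampedField a ω (σ • x) = σ • dampedField a ω x := by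
  ext <;> simp [dampedField]; ring

lemma dampedField_sub (x y : ℝ × ℝ) :
    dampedField a ω (x - y) = dampedField a ω x - dampedField a ω y := by
  ext <;> simp [dampedField]; ring

/-- A quadratic form that is conserved along the damped flow. -/
noncomputable def dampedEnergy (a ω t : ℝ) (x : ℝ × ℝ) : ℝ :=
  Real.exp (2 * a * t) * (ω ^ 2 * (x.1 * x.1) + (x.2 + a * x.1) * (x.2 + a * x.1))

lemma dampedEnergy_zero_right (t : ℝ) : dampedEnergy a ω t 0 = 0 := by simp [dampedEnergy]

lemma eq_zero_of_dampedEnergy_eq_zero (hω : 0 < ω) {t : ℝ} {x : ℝ × ℝ}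
    (h : dampedEnergy a ω t x = 0) : x = 0 := by
  have h1 : ω ^ 2 * (x.1 * x.1) + (x.2 + a * x.1) * (x.2 + a * x.1) = 0 :=
    (mul_eq_zero.1 h).resolve_left (Real.exp_pos _).ne'
  have h2 : 0 ≤ ω ^ 2 * (x.1 * x.1) := mul_nonneg (by positivity) (mul_self_nonneg _)
  have h3 := mul_self_nonneg (x.2 + a * x.1)
  have h4 : x.1 = 0 := by
    have : ω ^ 2 * (x.1 * x.1) = 0 := by linarith
    simpa [hω.ne'] using this
  have h5 : x.2 + a * x.1 = 0 := mul_self_eq_zero.1 (by linarith)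
  ext
  · exact h4
  · simpa [h4] using h5

/-- The function `y = exp (a t) x₁` solves `y'' + ω² y = 0`, and `dampedEnergy` is its energy `ω² y²
+ y'²`. -/
lemma hasDerivWithinAt_dampedEnergy {z : ℝ → ℝ × ℝ} {S : Set ℝ} {t : ℝ}
    (h : HasDerivWithinAt z (dampedField a ω (z t)) S t) :
    HasDerivWithinAt (fun s => dampedEnergy a ω s (z s)) 0 S t := by
  have h1 : HasDerivWithinAt (fun s => (z s).1) (z t).2 S t := by
    simpa [dampedField] using h.hasFDerivWithinAt.fst.hasDerivWithinAt
  have h2 : HasDerivWithinAt (fun s => (z s).2)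
      (-(2 * a) * (z t).2 - (a ^ 2 + ω ^ 2) * (z t).1) S t := by
    simpa [dampedField] using h.hasFDerivWithinAt.snd.hasDerivWithinAt
  have h3 := h2.add (h1.const_mul a)
  have he : HasDerivWithinAt (fun s => Real.exp (2 * a * s))
      (Real.exp (2 * a * t) * (2 * a)) S t := by
    simpa using (((hasDerivAt_id t).const_mul (2 * a)).exp).hasDerivWithinAt
  refine (he.mul (((h1.mul h1).const_mul (ω ^ 2)).add (h3.mul h3))).congr_deriv ?_
  simp only [Pi.add_apply, Pi.mul_apply]
  ring

lemma exists_dampedEnergy_eq {z : ℝ → ℝ × ℝ} {s t : ℝ}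
    (hz : AbsolutelyContinuousOnInterval z s t)
    (hd : ∀ᵐ r, r ∈ uIcc s t → HasDerivAt z (dampedField a ω (z r)) r) :
    ∃ K, ∀ r ∈ uIcc s t, dampedEnergy a ω r (z r) = K := by
  -- Absolute continuity says that sums of increments tend to zero, and the sup distance on the
  -- product dominates the distance in each coordinate.
  have h1 : AbsolutelyContinuousOnInterval (fun r => (z r).1) s t :=
    squeeze_zero (fun _ => Finset.sum_nonneg fun _ _ => dist_nonneg)
      (fun _ => Finset.sum_le_sum fun _ _ => le_max_left _ _) hz
  have h2 : AbsolutelyContinuousOnInterval (fun r => (z r).2) s t :=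
    squeeze_zero (fun _ => Finset.sum_nonneg fun _ _ => dist_nonneg)
      (fun _ => Finset.sum_le_sum fun _ _ => le_max_right _ _) hz
  have he : AbsolutelyContinuousOnInterval (fun r => Real.exp (2 * a * r)) s t :=
    ContDiffOn.absolutelyContinuousOnInterval (by fun_prop)
  have h3 := h2.fun_add (h1.const_mul a)
  have hE : AbsolutelyContinuousOnInterval (fun r => dampedEnergy a ω r (z r)) s t :=
    he.fun_mul (((h1.fun_mul h1).const_mul (ω ^ 2)).fun_add (h3.fun_mul h3))
  refine hE.const_of_ae_hasDerivAt_zero (hd.mono fun r hr hrm => ?_)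
  rw [← hasDerivWithinAt_univ]
  exact hasDerivWithinAt_dampedEnergy (hr hrm).hasDerivWithinAt

/-- Carathéodory solutions of the damped oscillator are determined by one value. -/
lemma eq_zero_of_absolutelyContinuous {z : ℝ → ℝ × ℝ} {s t r₀ : ℝ} (hω : 0 < ω)
    (hz : AbsolutelyContinuousOnInterval z s t)
    (hd : ∀ᵐ r, r ∈ uIcc s t → HasDerivAt z (dampedField a ω (z r)) r)
    (hr₀ : r₀ ∈ uIcc s t) (h0 : z r₀ = 0) : ∀ r ∈ uIcc s t, z r = 0 := by
  obtain ⟨K, hK⟩ := exists_dampedEnergy_eq hz hd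
  intro r hr
  apply eq_zero_of_dampedEnergy_eq_zero (a := a) (t := r) hω
  rw [hK r hr, ← hK r₀ hr₀, h0, dampedEnergy_zero_right]

lemma eqOn_of_absolutelyContinuous {z y : ℝ → ℝ × ℝ} {s t r₀ : ℝ} (hω : 0 < ω)
    (hz : AbsolutelyContinuousOnInterval z s t)
    (hdz : ∀ᵐ r, r ∈ uIcc s t → HasDerivAt z (dampedField a ω (z r)) r)
    (hy : ContDiff ℝ 1 y) (hdy : ∀ r, HasDerivAt y (dampedField a ω (y r)) r)
    (hr₀ : r₀ ∈ uIcc s t) (h0 : z r₀ = y r₀) : ∀ r ∈ uIcc s t, z r = y r := by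
  intro r hr
  refine sub_eq_zero.1 (eq_zero_of_absolutelyContinuous (z := fun r => z r - y r) (a := a) hω
    (hz.fun_sub hy.contDiffOn.absolutelyContinuousOnInterval) ?_ hr₀ (sub_eq_zero.2 h0) r hr)
  filter_upwards [hdz] with r h hm
  rw [dampedField_sub]
  exact (h hm).sub (hdy r)

/-- The counterpart for the classical flows in `FlowsTo`, which have one-sided derivatives at the
endpoints. -/
lemma eqOn_of_hasDerivWithinAt {z y : ℝ → ℝ × ℝ} {s t r₀ : ℝ} (hω : 0 < ω)
    (hdz : ∀ r ∈ Icc s t, HasDerivWithinAt z (dampedField a ω (z r)) (Icc s t) r)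
    (hdy : ∀ r, HasDerivAt y (dampedField a ω (y r)) r)
    (hr₀ : r₀ ∈ Icc s t) (h0 : z r₀ = y r₀) : ∀ r ∈ Icc s t, z r = y r := by
  have hE : ∀ r ∈ Icc s t, HasDerivWithinAt (fun r => dampedEnergy a ω r (z r - y r)) 0
      (Icc s t) r := fun r hr => by
    apply hasDerivWithinAt_dampedEnergy
    rw [dampedField_sub]
    exact (hdz r hr).sub (hdy r).hasDerivWithinAt
  have hst : s ≤ t := hr₀.1.trans hr₀.2
  have hK : ∀ r ∈ Icc s t, dampedEnergy a ω r (z r - y r) = dampedEnergy a ω s (z s - y s) := by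
    refine constant_of_derivWithin_zero (fun r hr => (hE r hr).differentiableWithinAt) ?_
    intro r hr
    exact (hE r ⟨hr.1, hr.2.le⟩).derivWithin
      (uniqueDiffOn_Icc (hr.1.trans_lt hr.2) r ⟨hr.1, hr.2.le⟩)
  intro r hr
  refine sub_eq_zero.1 (eq_zero_of_dampedEnergy_eq_zero (a := a) (t := r) hω ?_)
  rw [hK r hr, ← hK r₀ hr₀, h0, sub_self, dampedEnergy_zero_right]

/-! ### The explicit arcs -/

/-- The solution that starts at abscissa `θ` with phase `β` and hits the axis `x₁ = 0` at time
`β / ω`. -/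
noncomputable def arc (a ω θ β t : ℝ) : ℝ × ℝ :=
  (θ / Real.sin β * (Real.exp (-(a * t)) * Real.sin (β - ω * t)),
    -(θ / Real.sin β * (Real.exp (-(a * t)) *
      (a * Real.sin (β - ω * t) + ω * Real.cos (β - ω * t)))))

lemma contDiff_arc : ContDiff ℝ 1 (arc a ω θ β) := by
  unfold arc
  fun_prop

lemma continuous_arc : Continuous (arc a ω θ β) := contDiff_arc.continuous

lemma hasDerivAt_arc (t : ℝ) :
    HasDerivAt (arc a ω θ β) (dampedField a ω (arc a ω θ β t)) t := by
  have he : HasDerivAt (fun t => Real.exp (-(a * t))) (Real.exp (-(a * t)) * (-a)) t := by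
    simpa using ((hasDerivAt_id t).const_mul a).neg.exp
  have hl : HasDerivAt (fun t => β - ω * t) (-ω) t := by
    simpa using ((hasDerivAt_id t).const_mul ω).const_sub β
  have hs := hl.sin
  have hc := hl.cos
  have h1 := (he.mul hs).const_mul (θ / Real.sin β)
  have h2 := ((he.mul ((hs.const_mul a).add (hc.const_mul ω))).const_mul (θ / Real.sin β)).neg
  refine (h1.prodMk h2).congr_deriv ?_
  ext <;> simp [dampedField, arc] <;> ring

lemma hasDerivAt_arc_fst (t : ℝ) :
    HasDerivAt (fun t => (arc a ω θ β t).1) (arc a ω θ β t).2 t := by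
  simpa [dampedField] using (hasDerivAt_arc t).hasFDerivAt.fst.hasDerivAt

lemma hasDerivAt_smul_arc_shift (σ s t : ℝ) :
    HasDerivAt (fun r => σ • arc a ω θ β (r - s))
      (dampedField a ω (σ • arc a ω θ β (t - s))) t := by
  rw [dampedField_smul]
  exact ((hasDerivAt_arc (t - s)).comp_sub_const t s).const_smul σ

lemma contDiff_smul_arc_shift (σ s : ℝ) : ContDiff ℝ 1 (fun r => σ • arc a ω θ β (r - s)) :=
  (contDiff_arc.comp (contDiff_id.sub contDiff_const)).const_smul σ

/-- The phases for which the initial velocity points outwards. -/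
def IsAdmissible (a ω β : ℝ) : Prop :=
  0 < β ∧ β < Real.pi ∧ a * Real.sin β + ω * Real.cos β ≤ 0

/-- Divided by `sin φ`, the expression is `a + ω cot φ`, which decreases on `(0, π)`. The identity
`h4` clears denominators, so that `φ' = π` is covered. Along an arc the velocity is a negative
multiple of this expression at `φ = β - ωt`. -/
lemma phase_neg_of_lt (hω : 0 < ω) {φ φ' : ℝ} (h0 : 0 ≤ φ) (hlt : φ < φ') (hπ : φ' ≤ Real.pi)
    (h : a * Real.sin φ + ω * Real.cos φ ≤ 0) : a * Real.sin φ' + ω * Real.cos φ' < 0 := by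
  have hφ : 0 < φ := by
    rcases h0.eq_or_lt with rfl | h0
    · simp at h; linarith
    · exact h0
  have h1 : 0 < Real.sin φ := Real.sin_pos_of_pos_of_lt_pi hφ (by linarith)
  have h2 : 0 ≤ Real.sin φ' := Real.sin_nonneg_of_nonneg_of_le_pi (by linarith) hπ
  have h3 : 0 < Real.sin (φ' - φ) := Real.sin_pos_of_pos_of_lt_pi (by linarith) (by linarith)
  have h4 : Real.sin φ * (a * Real.sin φ' + ω * Real.cos φ') =
      Real.sin φ' * (a * Real.sin φ + ω * Real.cos φ) - ω * Real.sin (φ' - φ) := by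
    rw [Real.sin_sub]; ring
  have h5 : Real.sin φ * (a * Real.sin φ' + ω * Real.cos φ') < 0 := by
    rw [h4]; nlinarith [mul_nonneg h2 (neg_nonneg.2 h), mul_pos hω h3]
  exact (pos_iff_neg_of_mul_neg h5).1 h1

lemma IsAdmissible.sin_pos (h : IsAdmissible a ω β) : 0 < Real.sin β :=
  Real.sin_pos_of_pos_of_lt_pi h.1 h.2.1

lemma arc_zero_fst (h : IsAdmissible a ω β) : (arc a ω θ β 0).1 = θ := by
  simp [arc, h.sin_pos.ne']

lemma arc_fst_pos (hω : 0 < ω) (hθ : 0 < θ) (h : IsAdmissible a ω β) {t : ℝ} (h0 : 0 ≤ t)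
    (ht : t < β / ω) : 0 < (arc a ω θ β t).1 := by
  have : 0 < Real.sin (β - ω * t) := by
    apply Real.sin_pos_of_pos_of_lt_pi
    · rw [lt_div_iff₀ hω] at ht; linarith
    · nlinarith [h.2.1, mul_nonneg hω.le h0]
  have := h.sin_pos
  simp only [arc]
  positivity

lemma arc_end (hω : 0 < ω) : arc a ω θ β (β / ω) =
    (0, -(θ / Real.sin β * (Real.exp (-(a * (β / ω))) * ω))) := by
  have : ω * (β / ω) = β := by field_simp
  simp [arc, this]

lemma arc_end_snd_neg (hω : 0 < ω) (hθ : 0 < θ) (h : IsAdmissible a ω β) :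
    (arc a ω θ β (β / ω)).2 < 0 := by
  rw [arc_end hω]
  have := h.sin_pos
  simp only [Left.neg_neg_iff]
  positivity

lemma arc_snd_nonneg_iff (hθ : 0 < θ) (h : IsAdmissible a ω β) (t : ℝ) :
    0 ≤ (arc a ω θ β t).2 ↔ a * Real.sin (β - ω * t) + ω * Real.cos (β - ω * t) ≤ 0 := by
  have h1 := h.sin_pos
  have h2 := Real.exp_pos (-(a * t))
  simp only [arc, Left.nonneg_neg_iff]
  rw [← mul_assoc, ← not_iff_not, not_le, not_le, mul_pos_iff_of_pos_left (by positivity)]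

lemma arc_snd_pos_iff (hθ : 0 < θ) (h : IsAdmissible a ω β) (t : ℝ) :
    0 < (arc a ω θ β t).2 ↔ a * Real.sin (β - ω * t) + ω * Real.cos (β - ω * t) < 0 := by
  have h1 := h.sin_pos
  have h2 := Real.exp_pos (-(a * t))
  simp only [arc, Left.neg_pos_iff]
  rw [← mul_assoc, ← not_iff_not, not_lt, not_lt, mul_nonneg_iff_of_pos_left (by positivity)]

/-- As long as the velocity has not become negative, the abscissa exceeds `θ`. -/
lemma lt_arc_fst (hω : 0 < ω) (hθ : 0 < θ) (h : IsAdmissible a ω β) {t : ℝ} (h0 : 0 < t)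
    (ht : t ≤ β / ω) (hv : 0 ≤ (arc a ω θ β t).2) : θ < (arc a ω θ β t).1 := by
  have hmono : StrictMonoOn (fun t => (arc a ω θ β t).1) (Icc 0 t) := by
    refine strictMonoOn_of_deriv_pos (convex_Icc 0 t) continuous_arc.fst.continuousOn ?_
    intro r hr
    rw [interior_Icc] at hr
    rw [(hasDerivAt_arc_fst r).deriv, arc_snd_pos_iff hθ h]
    rw [arc_snd_nonneg_iff hθ h] at hv
    rw [le_div_iff₀ hω] at ht
    -- The phase decreases in time: velocity nonnegative at `t` forces it to be positive at every
    -- earlier time.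
    refine phase_neg_of_lt hω ?_ ?_ ?_ hv
    · linarith
    · nlinarith [hr.2]
    · nlinarith [hr.1, h.2.1]
  have := hmono (left_mem_Icc.2 h0.le) (right_mem_Icc.2 h0.le) h0
  simpa [arc_zero_fst h] using this

/-- The abscissa is nonnegative throughout. While the velocity is nonnegative, the abscissa is at
least `θ`; otherwise `x₁ x₂ ≤ 0`. -/
lemma arc_mem_oscC (hω : 0 < ω) (hθ : 0 < θ) (h : IsAdmissible a ω β) {t : ℝ} (h0 : 0 ≤ t)
    (ht : t ≤ β / ω) : arc a ω θ β t ∈ oscC θ := by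
  have hx : 0 ≤ (arc a ω θ β t).1 := by
    rcases ht.eq_or_lt with rfl | ht
    · simp [arc_end hω]
    · exact (arc_fst_pos hω hθ h h0 ht).le
  rcases le_total (arc a ω θ β t).2 0 with hv | hv
  · exact Or.inl (mul_nonpos_of_nonneg_of_nonpos hx hv)
  · refine Or.inr ⟨?_, mul_nonneg hx hv⟩
    rw [abs_of_nonneg hx]
    rcases h0.eq_or_lt with rfl | h0
    · rw [arc_zero_fst h]
    · exact (lt_arc_fst hω hθ h h0 ht hv).le

lemma smul_mem_oscC {σ : ℝ} (hσ : σ = 1 ∨ σ = -1) {x : ℝ × ℝ} : σ • x ∈ oscC θ ↔ x ∈ oscC θ := by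
  rcases hσ with rfl | rfl <;> simp [oscC]

lemma smul_mem_curveC0 {σ : ℝ} (hσ : σ = 1 ∨ σ = -1) {x : ℝ × ℝ} :
    σ • x ∈ curveC0 θ ↔ x ∈ curveC0 θ := by
  rcases hσ with rfl | rfl <;> simp [curveC0]

/-- The flow leaves the flow set immediately after the arc has reached the jump set. -/
lemma exists_arc_notMem_oscC_of_lt (hω : 0 < ω) (hθ : 0 < θ) (h : IsAdmissible a ω β) {t : ℝ}
    (ht : β / ω < t) : ∃ r ∈ Ioo (β / ω) t, arc a ω θ β r ∉ oscC θ := by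
  have h1 : ∀ᶠ r in nhds (β / ω), (arc a ω θ β r).2 < 0 :=
    continuous_arc.snd.continuousAt.eventually_lt continuousAt_const (arc_end_snd_neg hω hθ h)
  have h2 : ∀ᶠ r in nhds (β / ω), |(arc a ω θ β r).1| < θ :=
    continuous_arc.fst.abs.continuousAt.eventually_lt continuousAt_const (by simpa [arc_end hω])
  have h3 : ∀ᶠ r in nhdsWithin (β / ω) (Ioi (β / ω)), r ∈ Ioo (β / ω) (min t ((β + Real.pi) / ω)) :=
    -- Up to time `(β + π) / ω` the phase stays above `-π`, so that its sine is negative. Then `x₁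
    -- x₂ > 0` while `|x₁| < θ`.
    Ioo_mem_nhdsGT (lt_min ht (by gcongr; linarith [Real.pi_pos]))
  obtain ⟨r, hr1, hr2, hr3⟩ :=
    ((h1.filter_mono nhdsWithin_le_nhds).and ((h2.filter_mono nhdsWithin_le_nhds).and h3)).exists
  refine ⟨r, ⟨hr3.1, hr3.2.trans_le (min_le_left _ _)⟩, ?_⟩
  have hs : Real.sin (β - ω * r) < 0 := by
    have h4 := hr3.1
    have h5 := hr3.2.trans_le (min_le_right _ _)
    rw [div_lt_iff₀ hω] at h4
    rw [lt_div_iff₀ hω] at h5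
    exact Real.sin_neg_of_neg_of_neg_pi_lt (by linarith) (by linarith)
  have hx : (arc a ω θ β r).1 < 0 := by
    have := h.sin_pos
    have := Real.exp_pos (-(a * r))
    exact mul_neg_of_pos_of_neg (by positivity) (mul_neg_of_pos_of_neg this hs)
  rintro (hC | hC)
  · exact absurd (mul_pos_of_neg_of_neg hx hr1) (not_lt.2 hC)
  · exact absurd hr2 (not_lt.2 hC.1)

/-- Before its initial time an arc with nonzero initial velocity is outside the flow set. -/
lemma exists_arc_notMem_oscC_of_neg (hθ : 0 < θ) (h : IsAdmissible a ω β)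
    (hv : 0 < (arc a ω θ β 0).2) {t : ℝ} (ht : t < 0) :
    ∃ r ∈ Ioo t 0, arc a ω θ β r ∉ oscC θ := by
  have h1 : ∀ᶠ r in nhds (0 : ℝ), 0 < (arc a ω θ β r).2 :=
    continuousAt_const.eventually_lt continuous_arc.snd.continuousAt hv
  have h2 : ∀ᶠ r in nhds (0 : ℝ), 0 < (arc a ω θ β r).1 :=
    continuousAt_const.eventually_lt continuous_arc.fst.continuousAt (by rwa [arc_zero_fst h])
  obtain ⟨ε, hε, hball⟩ := Metric.eventually_nhds_iff.1 (h1.and h2)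
  -- All of `[r, 0]` lies in the ball, so `x₁` increases to `θ` there. Hence `0 < x₁ < θ` and `x₂ >
  -- 0` at `r`.
  set r := max (t / 2) (-ε / 2)
  have hr0 : r < 0 := max_lt (by linarith) (by linarith)
  have hrε : -ε < r := lt_of_lt_of_le (by linarith) (le_max_right _ _)
  have hrt : t < r := lt_of_lt_of_le (by linarith) (le_max_left _ _)
  have hball' : ∀ u ∈ Icc r 0, 0 < (arc a ω θ β u).2 ∧ 0 < (arc a ω θ β u).1 := fun u hu =>
    hball (by rw [Real.dist_eq, sub_zero, abs_of_nonpos hu.2]; linarith [hu.1])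
  have hmono : StrictMonoOn (fun t => (arc a ω θ β t).1) (Icc r 0) := by
    refine strictMonoOn_of_deriv_pos (convex_Icc r 0) continuous_arc.fst.continuousOn ?_
    intro u hu
    rw [(hasDerivAt_arc_fst u).deriv]
    exact (hball' u (interior_subset hu)).1
  have hlt := hmono (left_mem_Icc.2 hr0.le) (right_mem_Icc.2 hr0.le) hr0
  simp only [arc_zero_fst h] at hlt
  obtain ⟨hr2, hr1⟩ := hball' r (left_mem_Icc.2 hr0.le)
  refine ⟨r, ⟨hrt, hr0⟩, ?_⟩
  rintro (hC | hC)
  · exact absurd (mul_pos hr1 hr2) (not_lt.2 hC)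
  · rw [mem_ofPred_eq, abs_of_pos hr1] at hC
    linarith [hC.1]

lemma arc_zero_mem_curveC0 (hθ : 0 < θ) (h : IsAdmissible a ω β) :
    arc a ω θ β 0 ∈ curveC0 θ := by
  refine Or.inl ⟨by rw [arc_zero_fst h, abs_of_pos hθ], ?_⟩
  rw [arc_zero_fst h]
  exact mul_nonneg hθ.le ((arc_snd_nonneg_iff hθ h 0).2 (by simpa using h.2.2))

/-- While the velocity is nonnegative, `x₁ > θ`; once it is negative, either `x₁ x₂ < 0` or the arc
is at its end, where `x₁ = 0`. -/
lemma arc_notMem_curveC0 (hω : 0 < ω) (hθ : 0 < θ) (h : IsAdmissible a ω β) {t : ℝ} (h0 : 0 < t)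
    (ht : t ≤ β / ω) : arc a ω θ β t ∉ curveC0 θ := by
  intro hC
  rcases le_or_gt 0 (arc a ω θ β t).2 with hv | hv
  · have h1 := lt_arc_fst hω hθ h h0 ht hv
    have h2 : |(arc a ω θ β t).1| ≤ θ := hC.elim (fun h => h.1.le) (fun h => h.1)
    linarith [le_abs_self (arc a ω θ β t).1]
  · rcases hC with hC | hC
    · rcases ht.eq_or_lt with rfl | ht
      · have := hC.1
        simp [arc_end hω] at this
        exact hθ.ne this
      · exact absurd (mul_neg_of_pos_of_neg (arc_fst_pos hω hθ h h0.le ht) hv) (not_lt.2 hC.2)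
    · exact hv.ne hC.2

/-- Every outgoing initial velocity is attained by an admissible phase. -/
lemma exists_arc_zero_eq (hω : 0 < ω) (hθ : 0 < θ) {v : ℝ} (hv : 0 ≤ v) (ha : 0 < a) :
    ∃ β, IsAdmissible a ω β ∧ arc a ω θ β 0 = (θ, v) := by
  -- The launch velocity is `-θ (a + ω cot β)`, so `cot β` must be `-(v + aθ)/(ωθ)`; and `cot (ψ +
  -- π/2) = -tan ψ`.
  set ψ := Real.arctan ((v + a * θ) / (ω * θ))
  have hψ : 0 < ψ := Real.arctan_pos.2 (by positivity)
  have hψ' : ψ < Real.pi / 2 := Real.arctan_lt_pi_div_two _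
  have hc : 0 < Real.cos ψ := Real.cos_arctan_pos _
  have hs : Real.sin ψ = (v + a * θ) / (ω * θ) * Real.cos ψ := by
    have : Real.tan ψ = _ := Real.tan_arctan ((v + a * θ) / (ω * θ))
    rw [Real.tan_eq_sin_div_cos] at this
    rw [← this]; field_simp
  have hsin : Real.sin (ψ + Real.pi / 2) = Real.cos ψ := Real.sin_add_pi_div_two ψ
  have hcos : Real.cos (ψ + Real.pi / 2) = -Real.sin ψ := Real.cos_add_pi_div_two ψ
  refine ⟨ψ + Real.pi / 2, ⟨by positivity, by linarith, ?_⟩, ?_⟩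
  · rw [hsin, hcos, hs]
    have : a * Real.cos ψ + ω * -((v + a * θ) / (ω * θ) * Real.cos ψ) =
        -(v / θ * Real.cos ψ) := by field_simp; ring
    rw [this, Left.neg_nonpos_iff]
    positivity
  · ext
    · simp [arc, hsin, hc.ne']
    · simp only [arc, mul_zero, neg_zero, Real.exp_zero, one_mul, sub_zero, hsin, hcos, hs]
      field_simp
      ring

end Flow

/-! ### Monotonicity and the unique fixed point of the return map. -/

section ReturnMap

variable {a ω θ β β' : ℝ}

lemma arc_zero_snd_lt (hω : 0 < ω) (hθ : 0 < θ) (h : IsAdmissible a ω β)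
    (h' : IsAdmissible a ω β') (hlt : β < β') : (arc a ω θ β 0).2 < (arc a ω θ β' 0).2 := by
  have h1 := h.sin_pos
  have h2 := h'.sin_pos
  have h3 : 0 < Real.sin (β' - β) :=
    Real.sin_pos_of_pos_of_lt_pi (by linarith) (by linarith [h.1, h'.2.1])
  have h4 : (arc a ω θ β' 0).2 - (arc a ω θ β 0).2 =
      θ * ω * Real.sin (β' - β) / (Real.sin β * Real.sin β') := by
    simp only [arc, mul_zero, neg_zero, Real.exp_zero, one_mul, sub_zero, Real.sin_sub]
    field_simp
    ring
  have h5 : 0 < θ * ω * Real.sin (β' - β) / (Real.sin β * Real.sin β') := by positivity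
  linarith

/-- The arrival speed is `θω / (exp (aβ/ω) sin β)`. The derivative of the denominator has the sign
of `a sin β + ω cos β`, which is negative beyond an admissible phase. -/
lemma arc_end_snd_lt (hω : 0 < ω) (hθ : 0 < θ) (h : IsAdmissible a ω β)
    (h' : IsAdmissible a ω β') (hlt : β < β') :
    (arc a ω θ β' (β' / ω)).2 < (arc a ω θ β (β / ω)).2 := by
  have hanti : StrictAntiOn (fun x => Real.exp (a * (x / ω)) * Real.sin x) (Icc β β') := by
    refine strictAntiOn_of_deriv_neg (convex_Icc β β') (by fun_prop) ?_
    intro x hx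
    rw [interior_Icc] at hx
    have hd : HasDerivAt (fun x => Real.exp (a * (x / ω)) * Real.sin x)
        (Real.exp (a * (x / ω)) * (a * (1 / ω)) * Real.sin x +
          Real.exp (a * (x / ω)) * Real.cos x) x :=
      ((((hasDerivAt_id x).div_const ω).const_mul a).exp).mul (Real.hasDerivAt_sin x)
    rw [hd.deriv]
    have h1 := phase_neg_of_lt hω h.1.le hx.1 (hx.2.le.trans h'.2.1.le) h.2.2
    have h2 : Real.exp (a * (x / ω)) * (a * (1 / ω)) * Real.sin x +
        Real.exp (a * (x / ω)) * Real.cos x =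
        Real.exp (a * (x / ω)) / ω * (a * Real.sin x + ω * Real.cos x) := by
      field_simp
    rw [h2]
    exact mul_neg_of_pos_of_neg (by positivity) h1
  have key := hanti (left_mem_Icc.2 hlt.le) (right_mem_Icc.2 hlt.le) hlt
  have hval : ∀ x, IsAdmissible a ω x → (arc a ω θ x (x / ω)).2 =
      -(θ * ω / (Real.exp (a * (x / ω)) * Real.sin x)) := fun x hx => by
    have := hx.sin_pos
    rw [arc_end hω, Real.exp_neg]
    field_simp
  rw [hval _ h, hval _ h', neg_lt_neg_iff]
  have := h'.sin_pos
  exact div_lt_div_of_pos_left (by positivity) (by positivity) key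

lemma arc_zero_snd_lt_iff (hω : 0 < ω) (hθ : 0 < θ) (h : IsAdmissible a ω β)
    (h' : IsAdmissible a ω β') : (arc a ω θ β 0).2 < (arc a ω θ β' 0).2 ↔ β < β' := by
  refine ⟨fun hlt => ?_, arc_zero_snd_lt hω hθ h h'⟩
  by_contra hle
  rcases (not_lt.1 hle).eq_or_lt with rfl | hgt
  · exact lt_irrefl _ hlt
  · exact lt_asymm hlt (arc_zero_snd_lt hω hθ h' h hgt)

/-- The phases whose arc returns to the jump set with the speed at which it started. -/
def IsClosing (a ω β : ℝ) : Prop :=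
  0 < β ∧ β < Real.pi ∧
    a * Real.sin β + ω * Real.cos β + ω * Real.exp (-(a * (β / ω))) = 0

lemma IsClosing.isAdmissible (hω : 0 < ω) (h : IsClosing a ω β) : IsAdmissible a ω β := by
  refine ⟨h.1, h.2.1, ?_⟩
  have : 0 < ω * Real.exp (-(a * (β / ω))) := by positivity
  linarith [h.2.2]

/-- The sum of the launch and arrival velocities is the closing expression times `-θ / sin β`. -/
lemma isClosing_iff (hω : 0 < ω) (hθ : 0 < θ) (h : IsAdmissible a ω β) :
    IsClosing a ω β ↔ (arc a ω θ β 0).2 = -(arc a ω θ β (β / ω)).2 := by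
  have h1 := h.sin_pos
  have h2 : (arc a ω θ β 0).2 + (arc a ω θ β (β / ω)).2 = -(θ / Real.sin β) *
      (a * Real.sin β + ω * Real.cos β + ω * Real.exp (-(a * (β / ω)))) := by
    rw [arc_end hω]
    simp only [arc, mul_zero, neg_zero, Real.exp_zero, one_mul, sub_zero]
    ring
  have h3 : -(θ / Real.sin β) ≠ 0 := neg_ne_zero.2 (by positivity)
  rw [← add_eq_zero_iff_eq_neg, h2, mul_eq_zero, or_iff_right h3]
  exact ⟨fun h => h.2.2, fun hz => ⟨h.1, h.2.1, hz⟩⟩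

lemma closing_pi_neg (ha : 0 < a) (hω : 0 < ω) :
    a * Real.sin Real.pi + ω * Real.cos Real.pi + ω * Real.exp (-(a * (Real.pi / ω))) < 0 := by
  have : Real.exp (-(a * (Real.pi / ω))) < 1 := by
    rw [Real.exp_lt_one_iff]
    have := Real.pi_pos
    simp only [Left.neg_neg_iff]
    positivity
  simp only [Real.sin_pi, Real.cos_pi]
  nlinarith

lemma exists_isClosing (ha : 0 < a) (hω : 0 < ω) : ∃ β, IsClosing a ω β := by
  have hcont : ContinuousOn (fun x => a * Real.sin x + ω * Real.cos x +
      ω * Real.exp (-(a * (x / ω)))) (Icc 0 Real.pi) := by fun_prop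
  have h := intermediate_value_Ioo' Real.pi_pos.le hcont
  obtain ⟨β, hβ, h0⟩ := h ⟨closing_pi_neg ha hω, by simp; linarith⟩
  exact ⟨β, hβ.1, hβ.2, h0⟩

/-- Beyond `β` the second derivative `-(a sin x + ω cos x) + (a²/ω) exp (-ax/ω)` is positive. A
convex function that vanishes at `β` and `β'` cannot be negative at `π`. -/
lemma IsClosing.not_lt (ha : 0 < a) (hω : 0 < ω) (h : IsClosing a ω β) (h' : IsClosing a ω β') :
    ¬ β < β' := by
  intro hlt
  set g : ℝ → ℝ := fun x => a * Real.sin x + ω * Real.cos x + ω * Real.exp (-(a * (x / ω)))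
  set g' : ℝ → ℝ := fun x => a * Real.cos x + ω * (-Real.sin x) +
    ω * (Real.exp (-(a * (x / ω))) * (-(a * (1 / ω))))
  set g'' : ℝ → ℝ := fun x => a * (-Real.sin x) + ω * (-Real.cos x) +
    ω * (Real.exp (-(a * (x / ω))) * (-(a * (1 / ω))) * (-(a * (1 / ω))))
  have he : ∀ x : ℝ, HasDerivAt (fun x => Real.exp (-(a * (x / ω))))
      (Real.exp (-(a * (x / ω))) * (-(a * (1 / ω)))) x := fun x =>
    (((hasDerivAt_id x).div_const ω).const_mul a).neg.exp
  have hd1 : ∀ x, HasDerivAt g (g' x) x := fun x =>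
    (((Real.hasDerivAt_sin x).const_mul a).add ((Real.hasDerivAt_cos x).const_mul ω)).add
      ((he x).const_mul ω)
  have hd2 : ∀ x, HasDerivAt g' (g'' x) x := fun x =>
    (((Real.hasDerivAt_cos x).const_mul a).add ((Real.hasDerivAt_sin x).neg.const_mul ω)).add
      (((he x).mul_const _).const_mul ω)
  have hconv : ConvexOn ℝ (Icc β Real.pi) g := by
    refine convexOn_of_hasDerivWithinAt2_nonneg (f' := g') (f'' := g'') (convex_Icc _ _)
      (fun x _ => (hd1 x).continuousAt.continuousWithinAt)
      (fun x _ => (hd1 x).hasDerivWithinAt) (fun x _ => (hd2 x).hasDerivWithinAt) ?_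
    intro x hx
    rw [interior_Icc] at hx
    have h1 := phase_neg_of_lt hω h.1.le hx.1 hx.2.le (h.isAdmissible hω).2.2
    have h2 : 0 ≤ ω * (Real.exp (-(a * (x / ω))) * (-(a * (1 / ω))) * (-(a * (1 / ω)))) := by
      rw [mul_assoc (Real.exp _), neg_mul_neg]
      positivity
    simp only [g'']
    linarith
  have hb : g β = 0 := h.2.2
  have hb' : g β' = 0 := h'.2.2
  have hp : g Real.pi < 0 := closing_pi_neg ha hω
  have hs := hconv.slope_mono_adjacent (left_mem_Icc.2 h.2.1.le)
    (right_mem_Icc.2 h.2.1.le) hlt h'.2.1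
  rw [hb, hb', sub_self, zero_div] at hs
  have : (g Real.pi - 0) / (Real.pi - β') < 0 :=
    div_neg_of_neg_of_pos (by linarith) (by linarith [h'.2.1])
  linarith

lemma IsClosing.unique (ha : 0 < a) (hω : 0 < ω) (h : IsClosing a ω β) (h' : IsClosing a ω β') :
    β = β' :=
  le_antisymm (le_of_not_gt (h'.not_lt ha hω h)) (le_of_not_gt (h.not_lt ha hω h'))

/-- A periodic sequence whose increments keep their sign is constant at the start. -/
lemma eq_of_periodic_of_increments {u : ℕ → ℝ} {J : ℕ} (hJ : 0 < J) (hper : u J = u 0)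
    (hlt : ∀ n, u n < u (n + 1) → u (n + 1) < u (n + 2))
    (hgt : ∀ n, u (n + 1) < u n → u (n + 2) < u (n + 1)) : u 1 = u 0 := by
  rcases lt_trichotomy (u 0) (u 1) with h | h | h
  · have : StrictMono u := strictMono_nat_of_lt_succ fun n => by
      induction n with
      | zero => exact h
      | succ n ih => exact hlt n ih
    exact absurd hper (this hJ).ne'
  · exact h.symm
  · have : StrictAnti u := strictAnti_nat_of_succ_lt fun n => by
      induction n with
      | zero => exact h
      | succ n ih => exact hgt n ih
    exact absurd hper (this hJ).ne

/-- A periodic sequence of phases that is generated by the return map consists of closing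
phases. -/
lemma isClosing_of_periodic (hω : 0 < ω) (hθ : 0 < θ) {b : ℕ → ℝ} {J : ℕ} (hJ : 0 < J)
    (hadm : ∀ n, IsAdmissible a ω (b n))
    (hstep : ∀ n, (arc a ω θ (b (n + 1)) 0).2 = -(arc a ω θ (b n) (b n / ω)).2)
    (hper : ∀ n, (arc a ω θ (b (n + J)) 0).2 = (arc a ω θ (b n) 0).2) (n : ℕ) :
    IsClosing a ω (b n) := by
  rw [isClosing_iff hω hθ (hadm n), ← hstep]
  -- Strict monotonicity of the return map, transported through the phases.
  have hmono : ∀ i j, (arc a ω θ (b i) 0).2 < (arc a ω θ (b j) 0).2 →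
      (arc a ω θ (b (i + 1)) 0).2 < (arc a ω θ (b (j + 1)) 0).2 := fun i j hij => by
    rw [hstep, hstep, neg_lt_neg_iff]
    exact arc_end_snd_lt hω hθ (hadm i) (hadm j)
      ((arc_zero_snd_lt_iff hω hθ (hadm i) (hadm j)).1 hij)
  refine (eq_of_periodic_of_increments (u := fun i => (arc a ω θ (b (n + i)) 0).2) hJ (hper n)
    (fun i => ?_) (fun i => ?_)).symm
  · exact hmono (n + i) (n + i + 1)
  · exact hmono (n + i + 1) (n + i)

end ReturnMap

/-! ### Jump times of periodic hybrid time domains. -/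

section TimeDomain

variable {E : Set (ℝ × ℕ)}

/-- Within a truncation of a hybrid time domain, ordinary time is monotone in the jump counter. -/
lemma IsHybridTimeDomain.le_of_lt (hE : IsHybridTimeDomain E) {P : ℝ × ℕ} (hP : P ∈ E) {t s : ℝ}
    {i j : ℕ} (hti : (t, i) ∈ E) (hsj : (s, j) ∈ E) (ht : t ≤ P.1) (hs : s ≤ P.1) (hj : j ≤ P.2)
    (hij : i < j) : t ≤ s := by
  obtain ⟨K, τ, -, hmono, heq⟩ := hE.2 P hP
  have h1 : (t, i) ∈ E ∩ (Icc 0 P.1 ×ˢ Iic P.2) := ⟨hti, ⟨hE.1 _ hti, ht⟩, hij.le.trans hj⟩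
  have h2 : (s, j) ∈ E ∩ (Icc 0 P.1 ×ˢ Iic P.2) := ⟨hsj, ⟨hE.1 _ hsj, hs⟩, hj⟩
  rw [heq] at h1 h2
  have h3 : ∀ n, i + 1 ≤ n → n ≤ K → τ (i + 1) ≤ τ n := fun n hn => by
    induction n, hn using Nat.le_induction with
    | base => exact fun _ => le_rfl
    | succ n _ ih => exact fun hK => (ih (by omega)).trans (hmono n (by omega))
  exact h1.2.2.trans ((h3 j hij h2.1.le).trans h2.2.1)

lemma IsHybridTimeDomain.mem_of_mem_Icc (hE : IsHybridTimeDomain E) {t r s : ℝ} {i : ℕ}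
    (ht : (t, i) ∈ E) (hs : (s, i) ∈ E) (hr : r ∈ Icc t s) : (r, i) ∈ E := by
  obtain ⟨K, τ, -, -, heq⟩ := hE.2 _ hs
  have h1 : (t, i) ∈ E ∩ (Icc 0 s ×ˢ Iic i) := ⟨ht, ⟨hE.1 _ ht, hr.1.trans hr.2⟩, mem_Iic.2 le_rfl⟩
  have h2 : (s, i) ∈ E ∩ (Icc 0 s ×ˢ Iic i) := ⟨hs, ⟨hE.1 _ hs, le_rfl⟩, mem_Iic.2 le_rfl⟩
  have h3 : (r, i) ∈ E ∩ (Icc 0 s ×ˢ Iic i) := by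
    rw [heq] at h1 h2 ⊢
    exact ⟨h1.1, h1.2.1.trans hr.1, hr.2.trans h2.2.2⟩
  exact h3.1

lemma IsHybridTimeDomain.exists_jump (hE : IsHybridTimeDomain E) {t : ℝ} {i j : ℕ}
    (ht : (t, j) ∈ E) (hij : i < j) : ∃ r ∈ Icc 0 t, (r, i) ∈ E ∧ (r, i + 1) ∈ E := by
  obtain ⟨K, τ, -, hmono, heq⟩ := hE.2 _ ht
  have h1 : (t, j) ∈ E ∩ (Icc 0 t ×ˢ Iic j) := ⟨ht, ⟨hE.1 _ ht, le_rfl⟩, mem_Iic.2 le_rfl⟩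
  rw [heq] at h1
  have hK : j < K := h1.1
  have h2 : (τ (i + 1), i) ∈ E ∩ (Icc 0 t ×ˢ Iic j) := by
    rw [heq]; exact ⟨by dsimp only; omega, hmono i (by omega), le_rfl⟩
  have h3 : (τ (i + 1), i + 1) ∈ E ∩ (Icc 0 t ×ˢ Iic j) := by
    rw [heq]; exact ⟨by dsimp only; omega, le_rfl, hmono (i + 1) (by omega)⟩
  exact ⟨τ (i + 1), h2.2.1, h2.1, h3.1⟩

/-- A directed hybrid time domain with infinitely many jumps is given by its jump times. -/
lemma IsHybridTimeDomain.exists_jumpTimes (hE : IsHybridTimeDomain E) (h0 : ((0 : ℝ), 0) ∈ E)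
    (hdir : ∀ (t : ℝ) (n : ℕ), ∃ P ∈ E, t ≤ P.1 ∧ n ≤ P.2) :
    ∃ τ : ℕ → ℝ, ∀ (t : ℝ) (j : ℕ), (t, j) ∈ E ↔ t ∈ Icc (τ j) (τ (j + 1)) := by
  have hle : ∀ {t s : ℝ} {i j : ℕ}, (t, i) ∈ E → (s, j) ∈ E → i < j → t ≤ s := by
    intro t s i j hti hsj hij
    obtain ⟨P, hP, h1, h2⟩ := hdir (max t s) j
    exact hE.le_of_lt hP hti hsj ((le_max_left _ _).trans h1) ((le_max_right _ _).trans h1) h2 hij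
  have hjump : ∀ n : ℕ, ∃ r : ℝ, (r, n) ∈ E ∧ (r, n + 1) ∈ E := by
    intro n
    obtain ⟨P, hP, -, hn⟩ := hdir 0 (n + 1)
    obtain ⟨r, -, hr⟩ := hE.exists_jump (t := P.1) (j := P.2) hP hn
    exact ⟨r, hr⟩
  choose σ hσ hσ' using hjump
  -- `τ 0 = 0` is the initial time, and `τ (n + 1)` is the time of the jump from `n` to `n + 1`.
  refine ⟨fun n => Nat.casesOn n 0 σ, fun t j => ⟨fun ht => ⟨?_, ?_⟩, fun ht => ?_⟩⟩
  · cases j with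
    | zero => exact hE.1 _ ht
    | succ j => exact hle (hσ j) ht (Nat.lt_succ_self j)
  · exact hle ht (hσ' j) (Nat.lt_succ_self j)
  · cases j with
    | zero => exact hE.mem_of_mem_Icc h0 (hσ 0) ht
    | succ j => exact hE.mem_of_mem_Icc (hσ' j) (hσ (j + 1)) ht

lemma mem_add_mul {T : ℝ} {J : ℕ} (hper : ∀ (t : ℝ) (j : ℕ), (t, j) ∈ E → (t + T, j + J) ∈ E)
    (h0 : ((0 : ℝ), 0) ∈ E) (n : ℕ) : ((n : ℝ) * T, n * J) ∈ E := by
  induction n with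
  | zero => simpa using h0
  | succ n ih =>
    have := hper _ _ ih
    rwa [← add_one_mul, ← add_one_mul, ← Nat.cast_succ] at this

/-- Multiples of the period make the domain directed. A shift by the period carries both sides of a
jump into the domain, which pins down the shifted jump time. Time `0` need not be a jump, hence the
index `n + 1`. -/
lemma exists_jumpTimes_of_periodic (hE : IsHybridTimeDomain E) (h0 : ((0 : ℝ), 0) ∈ E) {T : ℝ}
    {J : ℕ} (hT : 0 < T) (hJ : 0 < J)
    (hper : ∀ (t : ℝ) (j : ℕ), (t, j) ∈ E → (t + T, j + J) ∈ E) :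
    ∃ τ : ℕ → ℝ, (∀ (t : ℝ) (j : ℕ), (t, j) ∈ E ↔ t ∈ Icc (τ j) (τ (j + 1))) ∧
      ∀ n, τ (n + 1 + J) = τ (n + 1) + T := by
  obtain ⟨τ, hτ⟩ := hE.exists_jumpTimes h0 fun t n => by
    obtain ⟨N, hN⟩ := exists_nat_ge (t / T)
    refine ⟨_, mem_add_mul hper h0 (max N n), ?_, ?_⟩
    · rw [div_le_iff₀ hT] at hN
      refine hN.trans ?_
      dsimp only
      gcongr
      exact le_max_left _ _
    · exact (le_max_right N n).trans (Nat.le_mul_of_pos_right _ hJ)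
  refine ⟨τ, hτ, fun n => ?_⟩
  have hmono : ∀ n, τ n ≤ τ (n + 1) := fun n => by
    obtain ⟨P, hP, h2⟩ : ∃ P ∈ E, n + 1 ≤ P.2 :=
      ⟨_, mem_add_mul hper h0 (n + 1), Nat.le_mul_of_pos_right _ hJ⟩
    obtain ⟨r, -, hr, -⟩ := hE.exists_jump (t := P.1) (j := P.2) hP h2
    exact ((hτ _ _).1 hr).1.trans ((hτ _ _).1 hr).2
  have h1 := (hτ _ _).1 (hper _ _ ((hτ (τ (n + 1)) n).2 ⟨hmono n, le_rfl⟩))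
  have h2 := (hτ _ _).1 (hper _ _ ((hτ (τ (n + 1)) (n + 1)).2 ⟨le_rfl, hmono (n + 1)⟩))
  rw [show n + J + 1 = n + 1 + J by omega] at h1
  exact le_antisymm h2.1 h1.2

/-- A hybrid time domain with a purely continuous period has no jumps. -/
lemma IsHybridTimeDomain.mem_iff_of_periodic (hE : IsHybridTimeDomain E) (h0 : ((0 : ℝ), 0) ∈ E)
    {T : ℝ} (hT : 0 < T) (hper : ∀ (t : ℝ) (j : ℕ), (t, j) ∈ E → (t + T, j) ∈ E) (t : ℝ) (j : ℕ) :
    (t, j) ∈ E ↔ 0 ≤ t ∧ j = 0 := by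
  have hzero : ∀ t : ℝ, 0 ≤ t → (t, 0) ∈ E := fun t ht => by
    obtain ⟨N, hN⟩ := exists_nat_ge (t / T)
    rw [div_le_iff₀ hT] at hN
    exact hE.mem_of_mem_Icc h0 (by simpa using mem_add_mul (J := 0) hper h0 N) ⟨ht, hN⟩
  refine ⟨fun ht => ⟨hE.1 _ ht, ?_⟩, fun ht => ht.2 ▸ hzero t ht.1⟩
  by_contra hj
  obtain ⟨r, hr, -, hr1⟩ := hE.exists_jump ht (Nat.pos_of_ne_zero hj)
  -- Level `0` contains `r + T` whereas level `1` contains `r`, so monotonicity gives `r + T ≤ r`.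
  have := hE.le_of_lt (hper _ _ hr1) (hzero (r + T) (by linarith [hr.1])) hr1 le_rfl
    (by dsimp only; linarith) le_rfl Nat.one_pos
  linarith

end TimeDomain

/-! ### Classification of nontrivial periodic trajectories. -/

section ResetSystem

variable {a ω θ β m c k : ℝ}

lemma exists_dampedField_eq (hm : 0 < m) (hc : 0 < c)
    (hunder : (c / (2 * m)) ^ 2 - k / m < 0) :
    ∃ a ω : ℝ, 0 < a ∧ 0 < ω ∧ oscField m c k = dampedField a ω := by
  refine ⟨c / (2 * m), Real.sqrt (k / m - (c / (2 * m)) ^ 2), by positivity,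
    Real.sqrt_pos.2 (by linarith), ?_⟩
  funext x
  ext
  · rfl
  · simp only [oscField, dampedField]
    rw [Real.sq_sqrt (by linarith)]
    field_simp
    ring

/-- The candidate for the periodic orbit: an arc together with its mirror image. -/
def cycle (a ω θ β : ℝ) : Set (ℝ × ℝ) :=
  {x | ∃ σ : ℝ, (σ = 1 ∨ σ = -1) ∧ ∃ s ∈ Icc 0 (β / ω), x = σ • arc a ω θ β s}

lemma cycle_nontrivial (hω : 0 < ω) (hθ : 0 < θ) (h : IsAdmissible a ω β) :
    (cycle a ω θ β).Nontrivial := by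
  have hT : 0 ≤ β / ω := (div_pos h.1 hω).le
  refine ⟨_, ⟨1, Or.inl rfl, 0, left_mem_Icc.2 hT, rfl⟩, _,
    ⟨1, Or.inl rfl, β / ω, right_mem_Icc.2 hT, rfl⟩, fun heq => ?_⟩
  have := congrArg Prod.fst heq
  simp [arc_zero_fst h, arc_end hω] at this
  exact hθ.ne' this

/-- A solution that starts just after a jump runs along an arc until it reaches the jump set. -/
lemma exists_eq_smul_arc (ha : 0 < a) (hω : 0 < ω) (hθ : 0 < θ) {ξ : ℝ → ℝ × ℝ} {s t σ v : ℝ}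
    (hst : s < t) (hξ : AbsolutelyContinuousOnInterval ξ s t)
    (hd : ∀ᵐ r, r ∈ uIcc s t → HasDerivAt ξ (dampedField a ω (ξ r)) r)
    (hC : ∀ r ∈ Ioo s t, ξ r ∈ oscC θ) (hσ : σ = 1 ∨ σ = -1) (hv : 0 ≤ v)
    (hs : ξ s = σ • (θ, v)) (ht : (ξ t).1 = 0) :
    ∃ β, IsAdmissible a ω β ∧ t = s + β / ω ∧ ∀ r ∈ Icc s t, ξ r = σ • arc a ω θ β (r - s) := by
  obtain ⟨β, hβ, h0⟩ := exists_arc_zero_eq hω hθ hv ha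
  have heq := eqOn_of_absolutelyContinuous hω hξ hd (contDiff_smul_arc_shift σ s)
    (hasDerivAt_smul_arc_shift (a := a) (ω := ω) (θ := θ) (β := β) σ s) left_mem_uIcc
    (by rw [sub_self, h0, hs])
  rw [uIcc_of_le hst.le] at heq
  have hσ0 : σ ≠ 0 := by rcases hσ with rfl | rfl <;> norm_num
  refine ⟨β, hβ, ?_, heq⟩
  -- Stopping earlier leaves `x₁ ≠ 0`; running longer leaves the flow set at an interior time.
  rcases lt_trichotomy (t - s) (β / ω) with h | h | h
  · have h1 := arc_fst_pos hω hθ hβ (sub_nonneg.2 hst.le) h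
    rw [heq t (right_mem_Icc.2 hst.le)] at ht
    simp [hσ0, h1.ne'] at ht
  · linarith
  · obtain ⟨r, hr, hrC⟩ := exists_arc_notMem_oscC_of_lt hω hθ hβ h
    have hpos : 0 < β / ω := div_pos hβ.1 hω
    have h1 := hC (r + s) ⟨by linarith [hr.1], by linarith [hr.2]⟩
    rw [heq (r + s) ⟨by linarith [hr.1], by linarith [hr.2]⟩, smul_mem_oscC hσ,
      add_sub_cancel_right] at h1
    exact absurd h1 hrC

/-- Since `x₂ = s |x₂|` for every `s` in `setSign x.2`, each reset state is a launch point with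
outward speed `|x₂|`, up to reflection. -/
lemma exists_smul_of_mem_oscG {x y : ℝ × ℝ} (h : y ∈ oscG θ x) :
    y.2 = x.2 ∧ ∃ σ : ℝ, (σ = 1 ∨ σ = -1) ∧ y = σ • (θ, |x.2|) := by
  obtain ⟨s, hs, rfl⟩ := h
  refine ⟨rfl, s, ?_⟩
  rcases hs with ⟨hne, rfl⟩ | ⟨h0, hs⟩
  · rcases hne.lt_or_gt with hlt | hgt
    · simp [Real.sign_of_neg hlt, abs_of_neg hlt]
    · simp [Real.sign_of_pos hgt, abs_of_pos hgt]
  · rcases hs with rfl | rfl <;> simp [h0]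

lemma notMem_oscD_of_mem_oscG (hθ : 0 < θ) {x y : ℝ × ℝ} (h : y ∈ oscG θ x) : y ∉ oscD := by
  obtain ⟨-, σ, hσ, rfl⟩ := exists_smul_of_mem_oscG h
  rcases hσ with rfl | rfl <;> simp [oscD, hθ.ne']

/-- A nontrivial periodic trajectory has a period with `T > 0` and `J > 0`. -/
lemma period_pos_of_nontrivial (hω : 0 < ω) (hθ : 0 < θ) (ha : 0 < a)
    (hF : oscField m c k = dampedField a ω) {E : Set (ℝ × ℕ)} {φ : ℝ → ℕ → ℝ × ℝ}
    (hsol : IsHybridSolution (resetSystem θ m c k) E φ) {T : ℝ} {J : ℕ}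
    (hTJ : (0 ≤ T ∧ 0 < J) ∨ (0 < T ∧ 0 ≤ J))
    (hper : ∀ (t : ℝ) (j : ℕ), (t, j) ∈ E → (t + T, j + J) ∈ E ∧ φ t j = φ (t + T) (j + J))
    (hnt : {x | ∃ p ∈ E, φ p.1 p.2 = x}.Nontrivial) : 0 < T ∧ 0 < J := by
  obtain ⟨⟨hE, hAC⟩, h0, -, hflow, hjump⟩ := hsol
  have hperE := fun t j h => (hper t j h).1
  constructor
  · by_contra hT
    have hT0 : T = 0 := by rcases hTJ with h | h <;> linarith [h.1]
    have hJ : 0 < J := by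
      rcases hTJ with h | h
      · exact h.2
      · exact absurd h.1 hT
    subst hT0
    -- With `T = 0`, two jumps would occur at time `0`, though the first one lands off the jump set.
    have h2 : ((0 : ℝ), 2 * J) ∈ E := by simpa using mem_add_mul hperE h0 2
    obtain ⟨r, hr, hr0, hr1⟩ := hE.exists_jump (i := 0) h2 (by omega)
    obtain ⟨r', hr', hr1', hr2'⟩ := hE.exists_jump (i := 1) h2 (by omega)
    obtain rfl : r = 0 := le_antisymm hr.2 hr.1
    obtain rfl : r' = 0 := le_antisymm hr'.2 hr'.1
    exact notMem_oscD_of_mem_oscG hθ (hjump _ _ hr0 hr1).2 (hjump _ _ hr1' hr2').1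
  · by_contra hJ
    obtain rfl : J = 0 := by omega
    have hT : 0 < T := by
      rcases hTJ with h | h
      · exact absurd h.2 hJ
      · exact h.1
    have hmem := hE.mem_iff_of_periodic h0 hT hperE
    have hslice : timeSlice E 0 = Ici 0 := by
      ext t; simp [timeSlice, hmem]
    have hae : ∀ t : ℝ, 0 ≤ t → ∀ᵐ r, r ∈ uIcc 0 t →
        HasDerivAt (fun s => φ s 0) (dampedField a ω (φ r 0)) r := by
      intro t ht
      have h1 := (hflow 0 (by rw [hslice, interior_Ici]; exact ⟨1, mem_Ioi.2 one_pos⟩)).2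
      rw [hslice, ae_restrict_iff' measurableSet_Ici] at h1
      filter_upwards [h1] with r hr hrt
      rw [uIcc_of_le ht] at hrt
      obtain ⟨v, hv, hdv⟩ := hr hrt.1
      rw [← hF, ← mem_singleton_iff.1 hv]
      exact hdv
    have hac : ∀ t : ℝ, 0 ≤ t → AbsolutelyContinuousOnInterval (fun s => φ s 0) 0 t :=
      fun t ht => hAC 0 0 h0 t ((hmem t 0).2 ⟨ht, rfl⟩)
    -- Without jumps, the conserved quantity at `0` and `T` differs by the factor `exp (2aT) > 1`,
    -- so a recurring state is the origin.
    obtain ⟨K, hK⟩ := exists_dampedEnergy_eq (hac T hT.le) (hae T hT.le)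
    have hKT := hK T right_mem_uIcc
    have hpT : φ 0 0 = φ T 0 := by simpa using (hper 0 0 h0).2
    rw [← hK 0 left_mem_uIcc, ← hpT] at hKT
    have h00 : φ 0 0 = 0 := by
      apply eq_zero_of_dampedEnergy_eq_zero (a := a) (t := 0) hω
      have hexp : 1 < Real.exp (2 * a * T) := Real.one_lt_exp_iff.2 (by positivity)
      simp only [dampedEnergy, mul_zero, Real.exp_zero, one_mul] at hKT ⊢
      have h3 : (Real.exp (2 * a * T) - 1) * (ω ^ 2 * ((φ 0 0).1 * (φ 0 0).1) +
        ((φ 0 0).2 + a * (φ 0 0).1) * ((φ 0 0).2 + a * (φ 0 0).1)) = 0 := by linarith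
      exact (mul_eq_zero.1 h3).resolve_left (by linarith)
    have hall : ∀ p ∈ E, φ p.1 p.2 = 0 := by
      rintro ⟨t, j⟩ hp
      obtain ⟨ht, rfl⟩ := (hmem t j).1 hp
      exact eq_zero_of_absolutelyContinuous hω (hac t ht) (hae t ht) left_mem_uIcc h00 t
        right_mem_uIcc
    obtain ⟨x, ⟨p, hp, rfl⟩, y, ⟨q, hq, rfl⟩, hxy⟩ := hnt
    exact hxy (by rw [hall p hp, hall q hq])

/-- Every nontrivial periodic orbit is the cycle of a closing phase. -/
lemma exists_eq_cycle (ha : 0 < a) (hω : 0 < ω) (hθ : 0 < θ)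
    (hF : oscField m c k = dampedField a ω) {O : Set (ℝ × ℝ)}
    (hO : IsHybridPeriodicOrbit (resetSystem θ m c k) O) (hnt : O.Nontrivial) :
    ∃ β, IsClosing a ω β ∧ O = cycle a ω θ β := by
  obtain ⟨E, φ, ⟨hsol, -, T, J, hTJ, hper⟩, rfl⟩ := hO
  obtain ⟨hT, hJ⟩ := period_pos_of_nontrivial hω hθ ha hF hsol hTJ hper hnt
  obtain ⟨⟨hE, hAC⟩, h0, -, hflow, hjump⟩ := hsol
  obtain ⟨τ, hτ, hτper⟩ :=
    exists_jumpTimes_of_periodic hE h0 hT hJ fun t j h => (hper t j h).1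
  have hmono : ∀ n, τ (n + 1) ≤ τ (n + 2) := fun n => by
    obtain ⟨r, -, hr, -⟩ := hE.exists_jump (i := n + 1)
      (mem_add_mul (fun t j h => (hper t j h).1) h0 (n + 2))
      (lt_of_lt_of_le (by omega) (Nat.le_mul_of_pos_right (n + 2) hJ))
    exact ((hτ _ _).1 hr).1.trans ((hτ _ _).1 hr).2
  have hmono' : ∀ n, τ n ≤ τ (n + 1) := fun n => by
    cases n with
    | succ n => exact hmono n
    | zero => exact ((hτ _ _).1 h0).1.trans ((hτ _ _).1 h0).2
  have hj : ∀ n, φ (τ (n + 1)) n ∈ oscD ∧ φ (τ (n + 1)) (n + 1) ∈ oscG θ (φ (τ (n + 1)) n) :=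
    fun n => hjump _ _ ((hτ _ _).2 ⟨hmono' n, le_rfl⟩) ((hτ _ _).2 ⟨le_rfl, hmono' (n + 1)⟩)
  have hstep : ∀ n, ∃ σ β : ℝ, (σ = 1 ∨ σ = -1) ∧ IsAdmissible a ω β ∧
      τ (n + 2) = τ (n + 1) + β / ω ∧
      ∀ r ∈ Icc (τ (n + 1)) (τ (n + 2)), φ r (n + 1) = σ • arc a ω θ β (r - τ (n + 1)) := by
    intro n
    obtain ⟨-, σ, hσ, hq⟩ := exists_smul_of_mem_oscG (hj n).2
    have hp := (hj (n + 1)).1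
    have hne : τ (n + 1) ≠ τ (n + 2) := fun heq => by
      refine notMem_oscD_of_mem_oscG hθ (hj n).2 ?_
      rw [heq]
      exact hp
    have hlt := lt_of_le_of_ne (hmono n) hne
    have hslice : timeSlice E (n + 1) = Icc (τ (n + 1)) (τ (n + 2)) := by
      ext t; exact hτ t (n + 1)
    obtain ⟨hC, hae⟩ := hflow (n + 1) (by rw [hslice, interior_Icc]; exact nonempty_Ioo.2 hlt)
    rw [hslice, interior_Icc] at hC
    rw [hslice, ae_restrict_iff' measurableSet_Icc] at hae
    obtain ⟨β, hβ, h1, h2⟩ := exists_eq_smul_arc (ξ := fun r => φ r (n + 1)) ha hω hθ hlt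
      (hAC (n + 1) _ ((hτ _ _).2 ⟨le_rfl, hmono n⟩) _ ((hτ _ _).2 ⟨hmono n, le_rfl⟩))
      (by
        filter_upwards [hae] with r hr hrt
        rw [uIcc_of_le hlt.le] at hrt
        obtain ⟨v, hv, hdv⟩ := hr hrt
        rw [← hF, ← mem_singleton_iff.1 hv]
        exact hdv)
      hC hσ (abs_nonneg _) hq hp
    exact ⟨σ, β, hσ, hβ, h1, h2⟩
  choose σ b hσ hb hτb harc using hstep
  have hstart : ∀ n, φ (τ (n + 1)) (n + 1) = σ n • arc a ω θ (b n) 0 := fun n => by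
    simpa using harc n _ (left_mem_Icc.2 (hmono n))
  have hend : ∀ n, φ (τ (n + 2)) (n + 1) = σ n • arc a ω θ (b n) (b n / ω) := fun n => by
    rw [harc n _ (right_mem_Icc.2 (hmono n)), hτb, add_sub_cancel_left]
  have hv0 : ∀ n, 0 ≤ (arc a ω θ (b n) 0).2 := fun n =>
    (arc_snd_nonneg_iff hθ (hb n) 0).2 (by simpa using (hb n).2.2)
  -- `x₂` is unchanged by the jump. Arrival velocity is negative and launch velocity nonnegative
  -- before reflection, so the reflection sign must flip.
  have hflip : ∀ n, σ (n + 1) = -σ n ∧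
      (arc a ω θ (b (n + 1)) 0).2 = -(arc a ω θ (b n) (b n / ω)).2 := by
    intro n
    have h1 := (exists_smul_of_mem_oscG (hj (n + 1)).2).1
    have h2 : σ (n + 1) * (arc a ω θ (b (n + 1)) 0).2 =
        σ n * (arc a ω θ (b n) (b n / ω)).2 := by
      rw [hstart (n + 1), hend n] at h1
      simpa using h1
    have h3 := arc_end_snd_neg hω hθ (hb n)
    have h4 := hv0 (n + 1)
    rcases hσ n with h | h <;> rcases hσ (n + 1) with h' | h' <;> rw [h, h'] at h2 ⊢ <;>
      constructor <;> linarith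
  have hvper : ∀ n, (arc a ω θ (b (n + J)) 0).2 = (arc a ω θ (b n) 0).2 := by
    intro n
    have h1 := (hper _ _ ((hτ (τ (n + 1)) (n + 1)).2 ⟨le_rfl, hmono n⟩)).2
    have h2 := hstart (n + J)
    rw [show n + J + 1 = n + 1 + J by omega, hτper, ← h1, hstart n] at h2
    have h3 : σ n * (arc a ω θ (b n) 0).2 = σ (n + J) * (arc a ω θ (b (n + J)) 0).2 := by
      simpa using congrArg Prod.snd h2
    have h4 := hv0 n
    have h5 := hv0 (n + J)
    rcases hσ n with h | h <;> rcases hσ (n + J) with h' | h' <;> rw [h, h'] at h3 <;> linarith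
  have hclose := isClosing_of_periodic hω hθ hJ hb (fun n => (hflip n).2) hvper
  have hbeq : ∀ n, b n = b 0 := fun n => (hclose n).unique ha hω (hclose 0)
  refine ⟨b 0, hclose 0, ?_⟩
  have hshift : ∀ n, ∀ s ∈ Icc 0 (b 0 / ω), τ (n + 1) + s ∈ Icc (τ (n + 1)) (τ (n + 2)) :=
    fun n s hs => by rw [hτb, hbeq n]; exact ⟨by linarith [hs.1], by linarith [hs.2]⟩
  ext x
  constructor
  · rintro ⟨⟨t, j⟩, hp, rfl⟩
    -- The piece before the first jump need not be a full arc. One period later the jump counter is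
    -- positive and the arc description applies.
    obtain ⟨hp', heq⟩ := hper t j hp
    obtain ⟨n, hn⟩ : ∃ n, j + J = n + 1 := ⟨j + J - 1, by omega⟩
    rw [hn] at hp' heq
    have hI := (hτ _ _).1 hp'
    refine ⟨σ n, hσ n, t + T - τ (n + 1), ?_, ?_⟩
    · have h2 := hI.2
      rw [hτb, hbeq n] at h2
      exact ⟨sub_nonneg.2 hI.1, by linarith⟩
    · rw [heq, harc n _ hI, hbeq n]
  · rintro ⟨s₀, hs₀, s, hs, rfl⟩
    -- The signs alternate, so both already occur among `σ 0` and `σ 1`.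
    obtain ⟨n, rfl⟩ : ∃ n, σ n = s₀ := by
      by_cases h : σ 0 = s₀
      · exact ⟨0, h⟩
      · refine ⟨1, ?_⟩
        rw [(hflip 0).1]
        rcases hσ 0 with h1 | h1 <;> rcases hs₀ with h2 | h2 <;> rw [h1, h2] at h <;>
          rw [h1, h2] <;> simp at h ⊢
    refine ⟨(τ (n + 1) + s, n + 1), (hτ _ _).2 (hshift n s hs), ?_⟩
    rw [harc n _ (hshift n s hs), hbeq n, add_sub_cancel_left]

end ResetSystem

/-! ### Construction of the periodic solution and its kinetic energies. -/

section Existence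

variable {a ω θ β m c k : ℝ}

/-- The hybrid time domain with jumps at the positive multiples of `D`. -/
def equidistantDomain (D : ℝ) : Set (ℝ × ℕ) := {p | p.1 ∈ Icc (p.2 * D) ((p.2 + 1) * D)}

lemma mem_equidistantDomain {D t : ℝ} {j : ℕ} :
    (t, j) ∈ equidistantDomain D ↔ j * D ≤ t ∧ t ≤ (j + 1) * D := Iff.rfl

lemma isHybridTimeDomain_equidistantDomain {D : ℝ} (hD : 0 ≤ D) :
    IsHybridTimeDomain (equidistantDomain D) := by
  refine ⟨fun p hp => (by positivity : (0 : ℝ) ≤ p.2 * D).trans hp.1, ?_⟩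
  rintro ⟨T, N⟩ hP
  obtain ⟨hP1, hP2⟩ := mem_equidistantDomain.1 hP
  have hT : 0 ≤ T := (by positivity : (0 : ℝ) ≤ N * D).trans hP1
  have hNle : ∀ i : ℕ, i ≤ N → (i : ℝ) * D ≤ T := fun i hi =>
    (by gcongr : (i : ℝ) * D ≤ N * D).trans hP1
  -- Capping the jump times at `T` cuts the last interval at the truncation point.
  refine ⟨N + 1, fun i => min (i * D) T, by simp [hT], fun i _ => ?_, ?_⟩
  · dsimp only
    gcongr
    exact Nat.le_succ i
  · ext ⟨t, j⟩
    simp only [mem_inter_iff, mem_equidistantDomain, mem_prod, mem_Icc, mem_Iic, mem_ofPred_eq,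
      Nat.lt_succ_iff, le_min_iff, Nat.cast_add, Nat.cast_one]
    constructor
    · rintro ⟨⟨h1, h2⟩, ⟨h3, h4⟩, h5⟩
      exact ⟨h5, (min_le_left _ _).trans h1, h2, h4⟩
    · rintro ⟨h5, h1, h2, h4⟩
      rw [min_eq_left (hNle j h5)] at h1
      exact ⟨⟨h1, h2⟩, ⟨(by positivity : (0 : ℝ) ≤ j * D).trans h1, h4⟩, h5⟩

lemma not_isBounded_equidistantDomain {D : ℝ} (hD : 0 ≤ D) :
    ¬ Bornology.IsBounded (equidistantDomain D) := by
  intro hb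
  obtain ⟨R, hR⟩ := (Metric.isBounded_iff_subset_closedBall ((0 : ℝ), 0)).1 hb
  obtain ⟨n, hn⟩ := exists_nat_gt R
  have h1 : ((n : ℝ) * D, n) ∈ equidistantDomain D :=
    mem_equidistantDomain.2 ⟨le_rfl, by gcongr; linarith⟩
  have h2 := (le_max_right _ _).trans (Metric.mem_closedBall.1 (hR h1))
  simp [Nat.dist_eq] at h2
  linarith

/-- The solution that runs alternately along an arc and its mirror image. -/
noncomputable def alternatingArc (a ω θ β t : ℝ) (j : ℕ) : ℝ × ℝ :=
  (-1 : ℝ) ^ j • arc a ω θ β (t - j * (β / ω))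

/-- At a closing phase the arrival velocity is minus the launch velocity, so the reset produces
exactly the launch point of the mirrored arc. -/
lemma smul_arc_jump (hω : 0 < ω) (hθ : 0 < θ) (h : IsClosing a ω β) {σ : ℝ}
    (hσ : σ = 1 ∨ σ = -1) :
    -σ • arc a ω θ β 0 ∈ oscG θ (σ • arc a ω θ β (β / ω)) := by
  have hadm := h.isAdmissible hω
  have h1 : (arc a ω θ β (β / ω)).2 = -(arc a ω θ β 0).2 := by
    rw [(isClosing_iff hω hθ hadm).1 h, neg_neg]
  have h2 : (arc a ω θ β (β / ω)).2 < 0 := arc_end_snd_neg hω hθ hadm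
  have h3 : -σ • arc a ω θ β 0 = (θ * -σ, (σ • arc a ω θ β (β / ω)).2) := by
    ext
    · simp [arc_zero_fst hadm, mul_comm]
    · simp [h1]
  refine ⟨-σ, Or.inl ?_, h3⟩
  rcases hσ with rfl | rfl
  · simp [h2.ne, Real.sign_of_neg h2]
  · have h4 : 0 < -(arc a ω θ β (β / ω)).2 := by linarith
    simp [h2.ne, Real.sign_of_pos h4]

lemma isHybridSolution_alternatingArc (hω : 0 < ω) (hθ : 0 < θ)
    (hF : oscField m c k = dampedField a ω) (h : IsClosing a ω β) :
    IsHybridSolution (resetSystem θ m c k) (equidistantDomain (β / ω))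
      (alternatingArc a ω θ β) := by
  have hadm := h.isAdmissible hω
  have hD : 0 ≤ β / ω := (div_pos h.1 hω).le
  have hC : ∀ t j, (t, j) ∈ equidistantDomain (β / ω) → alternatingArc a ω θ β t j ∈ oscC θ := by
    intro t j ht
    obtain ⟨h1, h2⟩ := mem_equidistantDomain.1 ht
    exact (smul_mem_oscC (neg_one_pow_eq_or ℝ j)).2
      (arc_mem_oscC hω hθ hadm (by linarith) (by linarith))
  have h00 : ((0 : ℝ), 0) ∈ equidistantDomain (β / ω) := by
    simpa [mem_equidistantDomain] using hD
  refine ⟨⟨isHybridTimeDomain_equidistantDomain hD, fun j s _ t _ => ?_⟩, h00,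
    Or.inl (subset_closure (hC 0 0 h00)), fun j _ =>
    ⟨fun t ht => hC t j (interior_subset (s := timeSlice _ j) ht), ?_⟩,
    fun t j h1 h2 => ?_⟩
  · exact (contDiff_smul_arc_shift _ _).contDiffOn.absolutelyContinuousOnInterval
  · refine Filter.Eventually.of_forall fun t => ⟨_, rfl, ?_⟩
    rw [hF]
    exact hasDerivAt_smul_arc_shift _ _ t
  · have ht : t = (j + 1) * (β / ω) := by
      refine le_antisymm (mem_equidistantDomain.1 h1).2 ?_
      simpa using (mem_equidistantDomain.1 h2).1
    have e1 : alternatingArc a ω θ β t j = (-1 : ℝ) ^ j • arc a ω θ β (β / ω) := by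
      rw [alternatingArc, ht]; congr 2; ring
    have e2 : alternatingArc a ω θ β t (j + 1) = -(-1 : ℝ) ^ j • arc a ω θ β 0 := by
      rw [alternatingArc, ht, pow_succ, mul_neg_one]; congr 2; push_cast; ring
    rw [e1, e2]
    exact ⟨by simp [resetSystem, oscD, arc_end hω], smul_arc_jump hω hθ h (neg_one_pow_eq_or ℝ j)⟩

lemma isHybridPeriodicOrbit_cycle (hω : 0 < ω) (hθ : 0 < θ)
    (hF : oscField m c k = dampedField a ω) (h : IsClosing a ω β) :
    IsHybridPeriodicOrbit (resetSystem θ m c k) (cycle a ω θ β) := by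
  have hD : 0 < β / ω := div_pos h.1 hω
  -- The period spans two arcs, after which the sign returns.
  refine ⟨equidistantDomain (β / ω), alternatingArc a ω θ β,
    ⟨isHybridSolution_alternatingArc hω hθ hF h, not_isBounded_equidistantDomain hD.le,
      2 * (β / ω), 2, Or.inl ⟨by positivity, two_pos⟩, fun t j ht => ⟨?_, ?_⟩⟩, ?_⟩
  · obtain ⟨h1, h2⟩ := mem_equidistantDomain.1 ht
    rw [mem_equidistantDomain]
    push_cast
    constructor <;> linarith
  · rw [alternatingArc, alternatingArc, pow_add, neg_one_sq, mul_one]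
    congr 2
    push_cast
    ring
  · ext x
    constructor
    · rintro ⟨σ, hσ, s, hs, rfl⟩
      obtain ⟨j, rfl⟩ : ∃ j : ℕ, (-1 : ℝ) ^ j = σ := by
        rcases hσ with rfl | rfl
        · exact ⟨0, pow_zero _⟩
        · exact ⟨1, pow_one _⟩
      refine ⟨(s + j * (β / ω), j), mem_equidistantDomain.2
        ⟨by linarith [hs.1], by linarith [hs.2]⟩, ?_⟩
      rw [alternatingArc, add_sub_cancel_right]
    · rintro ⟨⟨t, j⟩, ht, rfl⟩
      obtain ⟨h1, h2⟩ := mem_equidistantDomain.1 ht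
      exact ⟨_, neg_one_pow_eq_or ℝ j, _, ⟨by linarith, by linarith⟩, rfl⟩

/-! ### Kinetic energies along the cycle -/

lemma flowsTo_smul_arc (hω : 0 < ω) (hθ : 0 < θ) (hF : oscField m c k = dampedField a ω)
    (h : IsAdmissible a ω β) {σ s s' : ℝ} (hσ : σ = 1 ∨ σ = -1) (h0 : 0 ≤ s) (hs : s ≤ s')
    (hs' : s' ≤ β / ω) :
    FlowsTo θ m c k (σ • arc a ω θ β s) (σ • arc a ω θ β s') := by
  refine ⟨s' - s, fun t => σ • arc a ω θ β (t - -s), sub_nonneg.2 hs, by simp, by simp,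
    fun t ht => ⟨(smul_mem_oscC hσ).2 (arc_mem_oscC hω hθ h ?_ ?_), ?_⟩⟩
  · linarith [ht.1]
  · linarith [ht.2]
  · rw [hF]
    exact (hasDerivAt_smul_arc_shift _ _ t).hasDerivWithinAt

/-- By uniqueness a flow ending on the arc is the arc shifted in time. Starting before its launch
would leave the flow set, and after launch it never meets `C₀`. -/
lemma isBackwardIntersection_iff (hω : 0 < ω) (hθ : 0 < θ)
    (hF : oscField m c k = dampedField a ω) (h : IsClosing a ω β) {σ s : ℝ}
    (hσ : σ = 1 ∨ σ = -1) (h0 : 0 ≤ s) (hs : s ≤ β / ω) (b : ℝ × ℝ) :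
    IsBackwardIntersection θ m c k (σ • arc a ω θ β s) b ↔ b = σ • arc a ω θ β 0 := by
  have hadm := h.isAdmissible hω
  constructor
  · rintro ⟨hb, r, z, hr, rfl, hzr, hz⟩
    rw [hF] at hz
    have heq := eqOn_of_hasDerivWithinAt hω (fun t ht => (hz t ht).2)
      (hasDerivAt_smul_arc_shift (θ := θ) (β := β) σ (r - s)) (right_mem_Icc.2 hr)
      (by rw [hzr]; congr 2; ring)
    have hz0 := heq 0 (left_mem_Icc.2 hr)
    rw [hz0, smul_mem_curveC0 hσ] at hb
    rw [hz0]
    rcases lt_trichotomy (s - r) 0 with hlt | heq0 | hgt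
    · have hv : 0 < (arc a ω θ β 0).2 := by
        rw [(isClosing_iff hω hθ hadm).1 h]
        linarith [arc_end_snd_neg hω hθ hadm]
      obtain ⟨u, hu, huC⟩ := exists_arc_notMem_oscC_of_neg hθ hadm hv hlt
      have hut : u + (r - s) ∈ Icc 0 r := ⟨by linarith [hu.1], by linarith [hu.2]⟩
      have h2 := (hz _ hut).1
      rw [heq _ hut, smul_mem_oscC hσ, add_sub_cancel_right] at h2
      exact absurd h2 huC
    · congr 2; linarith
    · exact absurd hb (arc_notMem_curveC0 hω hθ hadm (by linarith) (by linarith))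
  · rintro rfl
    exact ⟨(smul_mem_curveC0 hσ).2 (arc_zero_mem_curveC0 hθ hadm),
      flowsTo_smul_arc hω hθ hF hadm hσ le_rfl h0 hs⟩

lemma isForwardIntersection_iff (hω : 0 < ω) (hθ : 0 < θ)
    (hF : oscField m c k = dampedField a ω) (hadm : IsAdmissible a ω β) {σ s : ℝ}
    (hσ : σ = 1 ∨ σ = -1) (h0 : 0 ≤ s) (hs : s ≤ β / ω) (e : ℝ × ℝ) :
    IsForwardIntersection θ m c k (σ • arc a ω θ β s) e ↔ e = σ • arc a ω θ β (β / ω) := by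
  constructor
  · rintro ⟨he, r, z, hr, hz0, rfl, hz⟩
    rw [hF] at hz
    have heq := eqOn_of_hasDerivWithinAt hω (fun t ht => (hz t ht).2)
      (hasDerivAt_smul_arc_shift (θ := θ) (β := β) σ (-s)) (left_mem_Icc.2 hr)
      (by rw [hz0]; congr 2; ring)
    have hzr := heq r (right_mem_Icc.2 hr)
    rw [hzr] at he ⊢
    rcases lt_trichotomy (r - -s) (β / ω) with hlt | heq0 | hgt
    · have h1 := arc_fst_pos hω hθ hadm (by linarith) hlt
      have hσ0 : σ ≠ 0 := by rcases hσ with rfl | rfl <;> norm_num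
      exact absurd he (mul_ne_zero hσ0 h1.ne')
    · rw [heq0]
    · obtain ⟨u, hu, huC⟩ := exists_arc_notMem_oscC_of_lt hω hθ hadm hgt
      have hut : u + -s ∈ Icc 0 r := ⟨by linarith [hu.1], by linarith [hu.2]⟩
      have h2 := (hz _ hut).1
      rw [heq _ hut, smul_mem_oscC hσ, add_sub_cancel_right] at h2
      exact absurd h2 huC
  · rintro rfl
    exact ⟨by simp [oscD, arc_end hω], flowsTo_smul_arc hω hθ hF hadm hσ h0 hs le_rfl⟩

end Existence

theorem theorem1 (θ m c k : ℝ) (hθ : 0 < θ) (hm : 0 < m) (hc : 0 < c) (hk : 0 < k)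
    (hunder : (c / (2 * m)) ^ 2 - k / m < 0) :
    (∃! O : Set (ℝ × ℝ), IsHybridPeriodicOrbit (resetSystem θ m c k) O ∧ O.Nontrivial) ∧
    ∀ O : Set (ℝ × ℝ), IsHybridPeriodicOrbit (resetSystem θ m c k) O → O.Nontrivial →
      ∀ x ∈ O,
        (∃! b, IsBackwardIntersection θ m c k x b) ∧
        (∃! e, IsForwardIntersection θ m c k x e) ∧
        backwardKinetic θ m c k x = forwardKinetic θ m c k x := by
  obtain ⟨a, ω, ha, hω, hF⟩ := exists_dampedField_eq hm hc hunder
  obtain ⟨β, hβ⟩ := exists_isClosing ha hω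
  have hadm := hβ.isAdmissible hω
  have hall : ∀ O : Set (ℝ × ℝ), IsHybridPeriodicOrbit (resetSystem θ m c k) O → O.Nontrivial →
      O = cycle a ω θ β := fun O hO hnt => by
    obtain ⟨β', hβ', rfl⟩ := exists_eq_cycle ha hω hθ hF hO hnt
    rw [hβ'.unique ha hω hβ]
  refine ⟨⟨cycle a ω θ β, ⟨isHybridPeriodicOrbit_cycle hω hθ hF hβ, cycle_nontrivial hω hθ hadm⟩,
    fun O hO => hall O hO.1 hO.2⟩, fun O hO hnt x hx => ?_⟩
  rw [hall O hO hnt] at hx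
  obtain ⟨σ, hσ, s, ⟨h0, hs⟩, rfl⟩ := hx
  have hb := isBackwardIntersection_iff hω hθ hF hβ hσ h0 hs
  have he := isForwardIntersection_iff hω hθ hF hadm hσ h0 hs
  refine ⟨⟨_, (hb _).2 rfl, fun b => (hb b).1⟩, ⟨_, (he _).2 rfl, fun e => (he e).1⟩, ?_⟩
  -- Uniqueness identifies the points selected by `Classical.epsilon` with the launch and arrival
  -- points.
  have hb' := (hb _).1 (Classical.epsilon_spec ⟨_, (hb _).2 rfl⟩)
  have he' := (he _).1 (Classical.epsilon_spec ⟨_, (he _).2 rfl⟩)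
  rw [backwardKinetic, forwardKinetic, hb', he']
  simp only [Prod.smul_snd, smul_eq_mul]
  rw [(isClosing_iff hω hθ hadm).1 hβ]
  ring
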